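/- Let $\mathfrak X\subseteq\mathcal P(\mathbb N)$ and fix a standard pairing function $\langle\cdot,\cdot\rangle$ on $\mathbb N$. Let $\mathbb N_{\mathfrak X}=\langle\mathbb N,A\rangle_{A\in\mathfrak X}$ be the standard model in the language $\mathcal L_{\mathfrak X}$ of arithmetic expanded by a unary predicate for each $A\in\mathfrak X$. $\mathfrak X$ is a *Scott set* if it is a Boolean algebra of sets, is closed under relative Turing computability, and contains a set coding a path through every infinite binary tree coded by a set in $\mathfrak X$; it is *arithmetically closed* if every subset of $\mathbb N$ definable in $\mathbb N_{\mathfrak X}$ belongs to $\mathfrak X$. $\mathfrak X/\mathrm{Fin}$ is the poset of infinite sets in $\mathfrak X$ ordered by almost inclusion ($A\le B$ iff $A\setminus B$ is finite). $\mathfrak X$ is a *proper Scott set* if it is an arithmetically closed Scott set and $\mathfrak X/\mathrm{Fin}$ is a proper forcing notion. A set $B\in\mathfrak X$ codes the sequence of sets $B_n=\{m\mid\langle n,m\rangle\in B\}$; a condition $C\in\mathfrak X/\mathrm{Fin}$ *decides* this sequence if $\{n\mid B_n\in U\}\in\mathfrak X$ for every ultrafilter $U$ on the Boolean algebra $\mathfrak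 X$ with $C\in U$. Let $\mathscr D_B$ be the set of conditions deciding $\langle B_n\mid n\in\mathbb N\rangle$. A function $f:\mathbb N\to\mathbb N$ is *coded in* $\mathfrak X$ if $\{\langle n,f(n)\rangle\mid n\in\mathbb N\}\in\mathfrak X$. For an ultrafilter $G$ on an arithmetically closed $\mathfrak X$, the ultrapower $\Pi_{\mathfrak X}\mathbb N/G$ is the $\mathcal L_{\mathfrak X}$-structure of all classes $[f]_G$ of functions coded in $\mathfrak X$, where $f\sim_G g$ iff $\{n\mid f(n)=g(n)\}\in G$, operations are pointwise, and a relation holds iff it holds pointwise on a set in $G$ (so $A$ is interpreted by $A'=\{[f]_G\mid\{n\mid f(n)\in A\}\in G\}$). An elementary extension $M\prec N$ is *conservative* if it is a proper extension and for every parametrically definable $D\subseteq N$ the set $D\cap M$ is parametrically definable in $M$. **Theorem.** Assume the Proper Forcing Axiom (for every proper poset $\mathbb P$ and every collection of at most $\omega_1$ dense subsets of $\mathbb P$ there is a filter on $\mathbb P$ meeting all of them). Let $\mathfrak X$ be a proper Scott set of size $\omega_1$. Then $\langle\mathbb N,A\rangle_{A\in\mathfrak X}$ has a conservative elementary extension.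 More precisely, there is an ultrafilter $G$ on $\mathfrak X$, all of whose members are infinite, such that for each of the (at most $\omega_1$ many) sequences $\langle B_n\mid n\in\mathbb N\rangle$ coded by a set $B\in\mathfrak X$ the set $\mathscr D_B$ is dense in $\mathfrak X/\mathrm{Fin}$ and $G\cap\mathscr D_B\neq\emptyset$, and such that the map $n\mapsto[c_n]_G$, where $c_n$ is the constant function with value $n$, is an elementary embedding that makes $\langle\Pi_{\mathfrak X}\mathbb N/G,A'\rangle_{A\in\mathfrak X}$ a conservative elementary extension of $\langle\mathbb N,A\rangle_{A\in\mathfrak X}$. -/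

import Mathlib

open Cardinal FirstOrder FirstOrder.Language

universe u

namespace Forcing

/-! ### Forcing notions, properness and the Proper Forcing Axiom

As usual in forcing, a "poset" is a nonempty preordered set; `p ≤ q` means that `p` is stronger. -/

/-- `D` is dense: every condition has an extension in `D`. -/
def IsDense {P : Type u} [Preorder P] (D : Set P) : Prop :=
  ∀ p : P, ∃ d ∈ D, d ≤ p

/-- Two conditions are compatible when they have a common extension. -/
def Compatible {P : Type u} [Preorder P] (p q : P) : Prop :=
  ∃ r : P, r ≤ p ∧ r ≤ q

/-- A maximal antichain: its elements are pairwise incompatible, and every condition is compatible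
with one of them. -/
def IsMaxAntichain {P : Type u} [Preorder P] (A : Set P) : Prop :=
  (∀ a ∈ A, ∀ b ∈ A, a ≠ b → ¬ Compatible a b) ∧ ∀ p : P, ∃ a ∈ A, Compatible a p

/-- The relation symbol of the language of set theory. -/
inductive SetRel : ℕ → Type
  | mem : SetRel 2

/-- The language of set theory, with one binary relation symbol. -/
def setLang : FirstOrder.Language.{0, 0} := ⟨fun _ => Empty, SetRel⟩

/-- `H_κ`: the sets whose transitive closure has size less than `κ`. The transitive closure of `x`
consists of all `y` with a finite chain `y ∈ ⋯ ∈ x`. -/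
def Hered (κ : Cardinal.{u}) : Set ZFSet.{u} :=
  {x | #{y : ZFSet.{u} // Relation.TransGen (· ∈ ·) y x} < Cardinal.lift.{u + 1} κ}

instance heredStructure (κ : Cardinal.{u}) : setLang.Structure (Hered κ) where
  funMap := fun f => f.elim
  RelMap := fun r => match r with
    | SetRel.mem => fun v => (v 0 : ZFSet.{u}) ∈ (v 1 : ZFSet.{u})

/-- The set `x` is an element of the elementary submodel `M` of `H_κ`. -/
def InModel {κ : Cardinal.{u}} (M : setLang.ElementarySubstructure (Hered κ)) (x : ZFSet.{u}) :
    Prop :=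
  ∃ h : x ∈ Hered κ, (⟨x, h⟩ : Hered κ) ∈ M

/-- The subset `A` of `P`, as a set, when the conditions of `P` are identified with sets by `e`. -/
noncomputable def codeSet {P : Type u} (e : P ↪ ZFSet.{u}) (A : Set P) : ZFSet.{u} :=
  ZFSet.range fun a : A => e a

/-- The isomorphic copy of the forcing notion `P` in the universe of sets that is given by the
injection `e`: the ordered pair of the set of conditions and the ordering. -/
noncomputable def codePoset {P : Type u} [Preorder P] (e : P ↪ ZFSet.{u}) : ZFSet.{u} :=
  ZFSet.pair (codeSet e Set.univ)
    (ZFSet.range fun z : {z : P × P // z.1 ≤ z.2} => ZFSet.pair (e z.1.1) (e z.1.2))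

/-- `q` is an `M`-generic condition: for every maximal antichain `A ∈ M`, the condition `q` forces
that the generic filter meets `A ∩ M`, that is, `A ∩ M` is predense below `q`. -/
def IsGenericCondition {P : Type u} [Preorder P] (e : P ↪ ZFSet.{u}) {κ : Cardinal.{u}}
    (M : setLang.ElementarySubstructure (Hered κ)) (q : P) : Prop :=
  ∀ A : Set P, IsMaxAntichain A → InModel M (codeSet e A) →
    ∀ r ≤ q, ∃ a ∈ A, InModel M (e a) ∧ Compatible a r

/-- Properness of a forcing notion `P`: for (every isomorphic copy of `P` among the sets and) every
cardinal `κ > 2 ^ |P|`, every countable `M ≺ H_κ` containing `P` and every condition `p ∈ M` there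
is an `M`-generic condition below `p`. -/
def IsProper (P : Type u) [Preorder P] : Prop :=
  ∀ (e : P ↪ ZFSet.{u}) (κ : Cardinal.{u}), 2 ^ #P < κ →
    ∀ M : setLang.ElementarySubstructure (Hered κ), Countable M → InModel M (codePoset e) →
      ∀ p : P, InModel M (e p) → ∃ q ≤ p, IsGenericCondition e M q

/-- The Proper Forcing Axiom: for every proper forcing notion `P` and every collection of at most
`ℵ₁` dense subsets of `P` there is a filter on `P` that meets all of them. -/
def ProperForcingAxiom : Prop :=
  ∀ (P : Type u) [Preorder P] [Nonempty P], IsProper P →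
    ∀ 𝒟 : Set (Set P), #𝒟 ≤ ℵ₁ → (∀ D ∈ 𝒟, IsDense D) →
      ∃ F : Order.PFilter P, ∀ D ∈ 𝒟, ∃ p ∈ F, p ∈ D

end Forcing

namespace Scott

/-! ### The structure `⟨ℕ, A⟩_{A ∈ X}` -/

/-- The function symbols of arithmetic. -/
inductive ArithFunc : ℕ → Type
  | zero : ArithFunc 0
  | one : ArithFunc 0
  | add : ArithFunc 2
  | mul : ArithFunc 2

/-- The order symbol of arithmetic and a unary predicate symbol for every `A ∈ X`. -/
inductive ArithRel (X : Set (Set ℕ)) : ℕ → Type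
  | lt : ArithRel X 2
  | pred (A : X) : ArithRel X 1

/-- The language of arithmetic expanded by unary predicates for the members of `X`. -/
def arithLang (X : Set (Set ℕ)) : FirstOrder.Language.{0, 0} := ⟨ArithFunc, ArithRel X⟩

-- The symbols, as symbols of the language `arithLang X`.

def zeroSym (X : Set (Set ℕ)) : (arithLang X).Functions 0 := ArithFunc.zero
def oneSym (X : Set (Set ℕ)) : (arithLang X).Functions 0 := ArithFunc.one
def addSym (X : Set (Set ℕ)) : (arithLang X).Functions 2 := ArithFunc.add
def mulSym (X : Set (Set ℕ)) : (arithLang X).Functions 2 := ArithFunc.mul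
def ltSym (X : Set (Set ℕ)) : (arithLang X).Relations 2 := ArithRel.lt
def predSym {X : Set (Set ℕ)} (A : X) : (arithLang X).Relations 1 := ArithRel.pred A

/-- The structure `⟨ℕ, A⟩_{A ∈ X}`. -/
instance natStructure (X : Set (Set ℕ)) : (arithLang X).Structure ℕ where
  funMap := fun f => match f with
    | ArithFunc.zero => fun _ => 0
    | ArithFunc.one => fun _ => 1
    | ArithFunc.add => fun v => v 0 + v 1
    | ArithFunc.mul => fun v => v 0 * v 1
  RelMap := fun r => match r with
    | ArithRel.lt => fun v => v 0 < v 1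
    | ArithRel.pred A => fun v => v 0 ∈ (A : Set ℕ)

/-! ### Scott sets -/

open Classical in
/-- The characteristic function of `A`. -/
noncomputable def charFun (A : Set ℕ) : ℕ →. ℕ :=
  fun n => Part.some (if n ∈ A then 1 else 0)

/-- A Scott set. Finite binary sequences are coded by numbers through the standard computable
coding of lists; a path through a tree is given by the set of those `n` at which it takes the
value `1`. -/
structure IsScottSet (X : Set (Set ℕ)) : Prop where
  empty_mem : ∅ ∈ X
  compl_mem : ∀ A ∈ X, Aᶜ ∈ X
  union_mem : ∀ A ∈ X, ∀ B ∈ X, A ∪ B ∈ X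
  computable_mem : ∀ A ∈ X, ∀ B : Set ℕ, TuringReducible (charFun B) (charFun A) → B ∈ X
  path_mem : ∀ T : Set (List Bool), T.Infinite → (∀ s t : List Bool, s <+: t → t ∈ T → s ∈ T) →
    Encodable.encode '' T ∈ X →
      ∃ P : ℕ → Bool, (∀ n, (List.range n).map P ∈ T) ∧ {n | P n = true} ∈ X

/-- `X` is arithmetically closed: every subset of `ℕ` definable in `⟨ℕ, A⟩_{A ∈ X}` is in `X`. -/
def ArithClosed (X : Set (Set ℕ)) : Prop :=
  ∀ B : Set ℕ, (∅ : Set ℕ).Definable₁ (arithLang X) B → B ∈ X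

/-- The conditions of the forcing notion `X/Fin`: the infinite members of `X`. -/
structure ModFin (X : Set (Set ℕ)) where
  carrier : Set ℕ
  mem : carrier ∈ X
  infinite : carrier.Infinite

/-- The ordering of `X/Fin` is almost inclusion. -/
instance (X : Set (Set ℕ)) : Preorder (ModFin X) where
  le A B := (A.carrier \ B.carrier).Finite
  le_refl A := by simp
  le_trans A B C hAB hBC := (hAB.union hBC).subset fun n hn => by
    by_cases h : n ∈ B.carrier
    · exact Or.inr ⟨h, hn.2⟩
    · exact Or.inl ⟨hn.1, h⟩

/-- A proper Scott set: an arithmetically closed Scott set `X` such that `X/Fin` is proper. -/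
structure IsProperScottSet (X : Set (Set ℕ)) : Prop where
  isScottSet : IsScottSet X
  arithClosed : ArithClosed X
  isProper : Forcing.IsProper (ModFin X)

/-! ### Ultrafilters on `X` -/

/-- An ultrafilter on the Boolean algebra of sets `X`. -/
structure UltrafilterOn (X : Set (Set ℕ)) where
  sets : Set (Set ℕ)
  sub : sets ⊆ X
  univ_mem : Set.univ ∈ sets
  empty_notMem : ∅ ∉ sets
  inter_mem : ∀ A ∈ sets, ∀ B ∈ sets, A ∩ B ∈ sets
  mem_of_superset : ∀ A ∈ sets, ∀ B ∈ X, A ⊆ B → B ∈ sets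
  mem_or_compl_mem : ∀ A ∈ X, A ∈ sets ∨ Aᶜ ∈ sets

/-- `G` consists of infinite sets. -/
def UltrafilterOn.Nonprincipal {X : Set (Set ℕ)} (G : UltrafilterOn X) : Prop :=
  ∀ A ∈ G.sets, A.Infinite

/-- The `n`-th set `B_n = {m | ⟨n, m⟩ ∈ B}` of the sequence coded by `B`. -/
def slice (B : Set ℕ) (n : ℕ) : Set ℕ := {m | Nat.pair n m ∈ B}

/-- `C ∈ X/Fin` decides the sequence `⟨B_n⟩` coded by `B`: whenever `U` is an ultrafilter on `X`
with `C ∈ U`, then `{n | B_n ∈ U} ∈ X`. -/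
def Decides {X : Set (Set ℕ)} (C : ModFin X) (B : Set ℕ) : Prop :=
  ∀ U : UltrafilterOn X, C.carrier ∈ U.sets → {n | slice B n ∈ U.sets} ∈ X

/-- The set of all conditions in `X/Fin` that decide the sequence coded by `B`. -/
def decidingSet (X : Set (Set ℕ)) (B : Set ℕ) : Set (ModFin X) := {C | Decides C B}

/-! ### Functions coded in `X` -/

/-- The function `f` is coded in `X`: its graph is (via the pairing function) in `X`. -/
def IsCoded (X : Set (Set ℕ)) (f : ℕ → ℕ) : Prop :=
  {k | ∃ n, k = Nat.pair n (f n)} ∈ X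

/-- The formula `k = ⟨a, b⟩`. -/
def pairFormula (X : Set (Set ℕ)) {α : Type} (k a b : (arithLang X).Term α) :
    (arithLang X).Formula α :=
  ((ltSym X).formula₂ a b ⊓
      Term.equal k ((addSym X).apply₂ ((mulSym X).apply₂ b b) a)) ⊔
    (∼((ltSym X).formula₂ a b) ⊓
      Term.equal k ((addSym X).apply₂ ((addSym X).apply₂ ((mulSym X).apply₂ a a) a) b))

theorem realize_pairFormula (X : Set (Set ℕ)) {α : Type} (k a b : (arithLang X).Term α)
    (v : α → ℕ) :
    (pairFormula X k a b).Realize v ↔ k.realize v = Nat.pair (a.realize v) (b.realize v) := by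
  have hlt : ∀ x y : ℕ, Structure.RelMap (ltSym X) ![x, y] ↔ x < y := fun _ _ => Iff.rfl
  have hadd : ∀ x y : ℕ, Structure.funMap (addSym X) ![x, y] = x + y := fun _ _ => rfl
  have hmul : ∀ x y : ℕ, Structure.funMap (mulSym X) ![x, y] = x * y := fun _ _ => rfl
  simp only [pairFormula, Formula.realize_sup, Formula.realize_inf, Formula.realize_not,
    Formula.realize_rel₂, Formula.realize_equal, Term.realize_functions_apply₂, hlt, hadd, hmul,
    Nat.pair]
  split_ifs with h <;> simp [h]

/-- The formula `f a = b`, for a function `f` whose graph is coded by `A ∈ X`. -/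
noncomputable def graphFormula (X : Set (Set ℕ)) (A : X) {α : Type} (a b : α) :
    (arithLang X).Formula α :=
  Formula.iExs (L := arithLang X) Unit
    (pairFormula X (Term.var (Sum.inr ())) (Term.var (Sum.inl a)) (Term.var (Sum.inl b)) ⊓
      (predSym A).formula₁ (Term.var (Sum.inr ())))

theorem realize_graphFormula {X : Set (Set ℕ)} {f : ℕ → ℕ} (hf : IsCoded X f) {α : Type}
    (a b : α) (v : α → ℕ) : (graphFormula X ⟨_, hf⟩ a b).Realize v ↔ f (v a) = v b := by
  have hp : ∀ (A : X) (x : ℕ), Structure.RelMap (predSym A) ![x] ↔ x ∈ (A : Set ℕ) := fun _ _ => Iff.rfl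
  simp only [graphFormula, Formula.realize_iExs, Formula.realize_inf, realize_pairFormula,
    Formula.realize_rel₁, hp, Term.realize_var, Sum.elim_inl, Sum.elim_inr, Set.mem_ofPred_eq]
  constructor
  · rintro ⟨i, h1, n, h2⟩
    rw [h1, Nat.pair_eq_pair] at h2
    rw [h2.1, h2.2]
  · intro h
    exact ⟨fun _ => Nat.pair (v a) (v b), rfl, v a, by rw [h]⟩

/-- For an arithmetically closed `X`, a relation definable in `⟨ℕ, A⟩_{A ∈ X}` pulls back along
coded functions to a member of `X`. -/
theorem ArithClosed.setOf_realize_mem {X : Set (Set ℕ)} (hX : ArithClosed X) {ι : Type} [Finite ι]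
    (φ : (arithLang X).Formula ι) (f : ι → ℕ → ℕ) (hf : ∀ i, IsCoded X (f i)) :
    {n | φ.Realize fun i => f i n} ∈ X := by
  apply hX
  rw [Set.Definable₁, Set.empty_definable_iff]
  refine ⟨Formula.iExs (L := arithLang X) ι (φ.relabel Sum.inr ⊓
    Formula.iInf fun i => graphFormula X ⟨_, hf i⟩ (Sum.inl (0 : Fin 1)) (Sum.inr i)), ?_⟩
  ext v
  simp only [Set.mem_ofPred_eq, Formula.realize_iExs, Formula.realize_inf, Formula.realize_relabel,
    Formula.realize_iInf, realize_graphFormula, Sum.elim_inl, Sum.elim_inr, Sum.elim_comp_inr]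
  constructor
  · intro h
    exact ⟨fun i => f i (v 0), h, fun i => rfl⟩
  · rintro ⟨w, hw, h⟩
    have : w = fun i => f i (v 0) := funext fun i => (h i).symm
    rwa [this] at hw

theorem ArithClosed.eq_mem {X : Set (Set ℕ)} (hX : ArithClosed X) {f g : ℕ → ℕ}
    (hf : IsCoded X f) (hg : IsCoded X g) : {n | f n = g n} ∈ X := by
  have := hX.setOf_realize_mem
    (Term.equal (Term.var 0) (Term.var 1) : (arithLang X).Formula (Fin 2)) ![f, g]
    (by intro i; fin_cases i <;> assumption)
  simpa using this

theorem ArithClosed.relMap_mem {X : Set (Set ℕ)} (hX : ArithClosed X) {k : ℕ}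
    (r : (arithLang X).Relations k) (f : Fin k → ℕ → ℕ) (hf : ∀ i, IsCoded X (f i)) :
    {n | Structure.RelMap r fun i => f i n} ∈ X := by
  simpa [Formula.realize_rel] using
    hX.setOf_realize_mem (r.formula fun i => Term.var i) f hf

/-- For an arithmetically closed `X`, the coded functions are closed under the operations of
arithmetic. -/
theorem ArithClosed.isCoded_funMap {X : Set (Set ℕ)} (hX : ArithClosed X) {k : ℕ}
    (F : (arithLang X).Functions k) (f : Fin k → ℕ → ℕ) (hf : ∀ i, IsCoded X (f i)) :
    IsCoded X fun n => Structure.funMap F fun i => f i n := by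
  apply hX
  rw [Set.Definable₁, Set.empty_definable_iff]
  refine ⟨Formula.iExs (L := arithLang X) (Option (Fin k))
    (pairFormula X (Term.var (Sum.inl (0 : Fin 1))) (Term.var (Sum.inr none))
        (Term.func F fun i => Term.var (Sum.inr (some i))) ⊓
      Formula.iInf fun i => graphFormula X ⟨_, hf i⟩ (Sum.inr none) (Sum.inr (some i))), ?_⟩
  ext v
  simp only [Set.mem_ofPred_eq, Formula.realize_iExs, Formula.realize_inf, realize_pairFormula,
    Formula.realize_iInf, realize_graphFormula, Sum.elim_inl, Sum.elim_inr, Term.realize_var,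
    Term.realize_func]
  constructor
  · rintro ⟨n, hn⟩
    exact ⟨fun o => o.elim n fun i => f i n, hn, fun i => rfl⟩
  · rintro ⟨w, hw, h⟩
    refine ⟨w none, ?_⟩
    rw [hw]
    simp only [h]

theorem ArithClosed.isCoded_const {X : Set (Set ℕ)} (hX : ArithClosed X) (c : ℕ) :
    IsCoded X fun _ => c := by
  induction c with
  | zero => exact hX.isCoded_funMap (zeroSym X) (fun _ _ => 0) fun i => i.elim0
  | succ c ih =>
    have h1 : IsCoded X fun _ => 1 :=
      hX.isCoded_funMap (oneSym X) (fun _ _ => 0) fun i => i.elim0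
    refine hX.isCoded_funMap (addSym X) ![fun _ => c, fun _ => 1] ?_
    intro i
    fin_cases i
    · exact ih
    · exact h1

/-- The type of functions `ℕ → ℕ` coded in `X`. -/
def CodedFun (X : Set (Set ℕ)) : Type := {f : ℕ → ℕ // IsCoded X f}

/-! ### The ultrapower `Π_X ℕ / G` -/

/-- `f ∼_G g` iff `{n | f n = g n} ∈ G`. -/
def ultraSetoid {X : Set (Set ℕ)} (hX : ArithClosed X) (G : UltrafilterOn X) :
    Setoid (CodedFun X) where
  r f g := {n | f.1 n = g.1 n} ∈ G.sets
  iseqv :=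
    { refl := fun f => by simpa using G.univ_mem
      symm := fun {f g} h => by simpa only [eq_comm] using h
      trans := fun {f g h} h1 h2 =>
        G.mem_of_superset _ (G.inter_mem _ h1 _ h2) _ (hX.eq_mem f.2 h.2)
          fun n hn => Eq.trans hn.1 hn.2 }

theorem UltrafilterOn.iInter_mem {X : Set (Set ℕ)} (G : UltrafilterOn X) :
    ∀ {k : ℕ} (A : Fin k → Set ℕ), (∀ i, A i ∈ G.sets) → {n | ∀ i, n ∈ A i} ∈ G.sets
  | 0, A, _ => by simpa using G.univ_mem
  | k + 1, A, h => by
    have := G.inter_mem _ (h 0) _ (G.iInter_mem (fun i : Fin k => A i.succ) fun i => h i.succ)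
    simp only [Fin.forall_fin_succ]
    exact this

/-- The operations on coded functions are pointwise, and a relation holds of coded functions iff it
holds pointwise on a set in `G`; both respect `∼_G`. -/
instance ultraPrestructure {X : Set (Set ℕ)} (hX : ArithClosed X) (G : UltrafilterOn X) :
    (arithLang X).Prestructure (ultraSetoid hX G) where
  toStructure :=
    { funMap := fun F f => ⟨fun n => Structure.funMap F fun i => (f i).1 n,
        hX.isCoded_funMap F _ fun i => (f i).2⟩
      RelMap := fun r f => {n | Structure.RelMap r fun i => (f i).1 n} ∈ G.sets }
  fun_equiv := fun {k F} f g h =>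
    G.mem_of_superset _ (G.iInter_mem _ h) _
      (hX.eq_mem (hX.isCoded_funMap F _ fun i => (f i).2) (hX.isCoded_funMap F _ fun i => (g i).2))
      fun n hn => congrArg (Structure.funMap F) (funext hn)
  rel_equiv := fun {k r} f g h => by
    have key : ∀ f g : Fin k → CodedFun X, (∀ i, {n | (f i).1 n = (g i).1 n} ∈ G.sets) →
        {n | Structure.RelMap r fun i => (f i).1 n} ∈ G.sets →
        {n | Structure.RelMap r fun i => (g i).1 n} ∈ G.sets := by
      intro f g h hf
      refine G.mem_of_superset _ (G.inter_mem _ (G.iInter_mem _ h) _ hf) _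
        (hX.relMap_mem r _ fun i => (g i).2) ?_
      rintro n ⟨hn, hr⟩
      have : (fun i => (f i).1 n) = fun i => (g i).1 n := funext hn
      simpa only [Set.mem_ofPred_eq, this] using hr
    exact propext ⟨key f g h, key g f fun i => (ultraSetoid hX G).symm (h i)⟩

/-- The ultrapower `Π_X ℕ / G`: the coded functions modulo `∼_G`. -/
def Ultrapower {X : Set (Set ℕ)} (hX : ArithClosed X) (G : UltrafilterOn X) : Type :=
  Quotient (ultraSetoid hX G)

/-- The ultrapower as a structure in the language expanded by predicates for all `A ∈ X`. -/
instance {X : Set (Set ℕ)} (hX : ArithClosed X) (G : UltrafilterOn X) :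
    (arithLang X).Structure (Ultrapower hX G) :=
  inferInstanceAs ((arithLang X).Structure (Quotient (ultraSetoid hX G)))

/-- The class `[f]_G`. -/
def Ultrapower.mk {X : Set (Set ℕ)} (hX : ArithClosed X) (G : UltrafilterOn X) (f : CodedFun X) :
    Ultrapower hX G :=
  Quotient.mk (ultraSetoid hX G) f

/-! ### Conservative extensions -/

/-- The elementary extension `j : M → N` is conservative: it is a proper extension, and the
restriction to `M` of every parametrically definable subset of `N` is parametrically definable
in `M`. -/
def IsConservative {L : FirstOrder.Language.{0, 0}} {M N : Type} [L.Structure M] [L.Structure N]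
    (j : M ↪ₑ[L] N) : Prop :=
  ¬ Function.Surjective j ∧
    ∀ D : Set N, (Set.univ : Set N).Definable₁ L D → (Set.univ : Set M).Definable₁ L (j ⁻¹' D)

end Scott

/-! The Proper Forcing Axiom for `X/Fin` gives a filter meeting ω₁ prescribed dense sets. The sets
`splittingSet X A` make the filter generate an ultrafilter `G` on `X`; the sets `decidingSet X B`
ensure that `{n | B_n ∈ G} ∈ X` for every coded sequence. Members of `G` almost contain an infinite
condition, so they are infinite.

Density of `decidingSet X B` (`isDense_decidingSet`) is a cohesiveness argument. Below `C`, choose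
for each `n` whether to go into `B_n` or its complement, keeping infinitely many elements of `C`;
the choices are arithmetical in `C` and `B`, so they form a set `P ∈ X`. A diagonal set `E ⊆ C` in
`X` is then almost contained in each chosen side. An ultrafilter containing `E` and all cofinite
sets computes exactly `P`; one containing a singleton `{k}` computes `{n | k ∈ B_n}`, which is also
in `X`.

Łoś's theorem (`realize_bounded_mk`) holds for coded functions because least counterexamples are
definable, hence coded by arithmetic closure. If `φ` defines `D` with parameters `[f_a]`, then
`[c_n] ∈ D` iff `B_n = {k | φ(f_a(k), n)}` lies in `G`. One `B ∈ X` codes all these `B_n`, so `D ∩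
ℕ` is in `X` and is named by a predicate. The class of the identity makes the extension proper. -/

namespace Scott

/-! ### Relations and functions definable in `⟨ℕ, A⟩_{A ∈ X}` -/

section Definability

variable {X : Set (Set ℕ)} {α β : Type}

/-- The relation `p` between numbers is definable without parameters in `⟨ℕ, A⟩_{A ∈ X}`. -/
def DefRel (X : Set (Set ℕ)) (p : (α → ℕ) → Prop) : Prop :=
  ∃ φ : (arithLang X).Formula α, ∀ v, φ.Realize v ↔ p v

/-- The function `t` has a definable graph in `⟨ℕ, A⟩_{A ∈ X}`. -/
def DefFun (X : Set (Set ℕ)) (t : (α → ℕ) → ℕ) : Prop :=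
  DefRel X fun w : Option α → ℕ => w none = t fun a => w (some a)

theorem DefRel.congr {p q : (α → ℕ) → Prop} (h : DefRel X p) (hpq : ∀ v, q v ↔ p v) :
    DefRel X q := by
  obtain ⟨φ, hφ⟩ := h
  exact ⟨φ, fun v => (hφ v).trans (hpq v).symm⟩

theorem DefRel.relabel {p : (α → ℕ) → Prop} (h : DefRel X p) (g : α → β) :
    DefRel X fun w : β → ℕ => p fun a => w (g a) := by
  obtain ⟨φ, hφ⟩ := h
  exact ⟨φ.relabel g, fun v => Formula.realize_relabel.trans (hφ _)⟩

theorem DefRel.not {p : (α → ℕ) → Prop} (h : DefRel X p) : DefRel X fun v => ¬ p v := by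
  obtain ⟨φ, hφ⟩ := h
  exact ⟨∼φ, fun v => by rw [Formula.realize_not, hφ]⟩

theorem DefRel.and {p q : (α → ℕ) → Prop} (hp : DefRel X p) (hq : DefRel X q) :
    DefRel X fun v => p v ∧ q v := by
  obtain ⟨φ, hφ⟩ := hp
  obtain ⟨ψ, hψ⟩ := hq
  exact ⟨φ ⊓ ψ, fun v => by rw [Formula.realize_inf, hφ, hψ]⟩

theorem DefRel.or {p q : (α → ℕ) → Prop} (hp : DefRel X p) (hq : DefRel X q) :
    DefRel X fun v => p v ∨ q v := by
  obtain ⟨φ, hφ⟩ := hp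
  obtain ⟨ψ, hψ⟩ := hq
  exact ⟨φ ⊔ ψ, fun v => by rw [Formula.realize_sup, hφ, hψ]⟩

theorem DefRel.imp {p q : (α → ℕ) → Prop} (hp : DefRel X p) (hq : DefRel X q) :
    DefRel X fun v => p v → q v :=
  (hp.not.or hq).congr fun _ => imp_iff_not_or

theorem DefRel.iff {p q : (α → ℕ) → Prop} (hp : DefRel X p) (hq : DefRel X q) :
    DefRel X fun v => p v ↔ q v :=
  ((hp.imp hq).and (hq.imp hp)).congr fun _ => iff_iff_implies_and_implies

/-- The bound variable is the new point `none` of `Option α`, so nested quantifiers iterate `Option`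
and definability proofs can follow the shape of the defining condition. -/
theorem DefRel.exists {p : (α → ℕ) → ℕ → Prop}
    (h : DefRel X fun w : Option α → ℕ => p (fun a => w (some a)) (w none)) :
    DefRel X fun v => ∃ n, p v n := by
  obtain ⟨φ, hφ⟩ := h
  refine ⟨Formula.iExs (L := arithLang X) Unit
    (φ.relabel fun o : Option α => o.elim (Sum.inr ()) Sum.inl), fun v => ?_⟩
  simp only [Formula.realize_iExs, Formula.realize_relabel, hφ, Function.comp_apply,
    Option.elim_some, Option.elim_none, Sum.elim_inl, Sum.elim_inr]
  exact ⟨fun ⟨i, hi⟩ => ⟨i (), hi⟩, fun ⟨n, hn⟩ => ⟨fun _ => n, hn⟩⟩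

theorem DefRel.forall {p : (α → ℕ) → ℕ → Prop}
    (h : DefRel X fun w : Option α → ℕ => p (fun a => w (some a)) (w none)) :
    DefRel X fun v => ∀ n, p v n :=
  (DefRel.exists (p := fun v n => ¬ p v n) h.not).not.congr fun _ => by simp

theorem DefRel.eq_var (a b : α) : DefRel X fun v : α → ℕ => v a = v b :=
  ⟨Term.equal (Term.var a) (Term.var b), fun v => by simp⟩

theorem DefRel.lt_var (a b : α) : DefRel X fun v : α → ℕ => v a < v b :=
  ⟨(ltSym X).formula₂ (Term.var a) (Term.var b), fun v => by
    rw [Formula.realize_rel₂]; exact Iff.rfl⟩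

theorem DefRel.mem_var {A : Set ℕ} (hA : A ∈ X) (a : α) : DefRel X fun v : α → ℕ => v a ∈ A :=
  ⟨(predSym ⟨A, hA⟩).formula₁ (Term.var a), fun v => by
    rw [Formula.realize_rel₁]; exact Iff.rfl⟩

/-! ### Definable functions and substitution -/

theorem DefFun.relabel {t : (α → ℕ) → ℕ} (h : DefFun X t) (g : α → β) :
    DefFun X fun w : β → ℕ => t fun a => w (g a) :=
  DefRel.relabel h (Option.map g)

theorem DefFun.weaken {t : (α → ℕ) → ℕ} (h : DefFun X t) :
    DefFun X fun w : Option α → ℕ => t fun a => w (some a) :=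
  h.relabel some

theorem DefFun.var (a : α) : DefFun X fun v : α → ℕ => v a :=
  DefRel.eq_var none (some a)

/-- Substitution of a definable function for a variable. -/
theorem DefRel.subst {p : (α → ℕ) → ℕ → Prop} {t : (α → ℕ) → ℕ}
    (h : DefRel X fun w : Option α → ℕ => p (fun a => w (some a)) (w none)) (ht : DefFun X t) :
    DefRel X fun v => p v (t v) :=
  (DefRel.exists (p := fun v n => n = t v ∧ p v n) (DefRel.and ht h)).congr fun v => by simp

/-- Substitution of definable functions for the variables of a formula. -/
theorem DefRel.realize_of_finite {ι : Type} [Finite ι] (φ : (arithLang X).Formula ι)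
    {t : ι → (α → ℕ) → ℕ} (ht : ∀ i, DefFun X (t i)) :
    DefRel X fun v => φ.Realize fun i => t i v := by
  choose ψ hψ using ht
  refine ⟨Formula.iExs (L := arithLang X) ι (φ.relabel Sum.inr ⊓
    Formula.iInf fun i => (ψ i).relabel fun o => o.elim (Sum.inr i) Sum.inl), fun v => ?_⟩
  simp only [Formula.realize_iExs, Formula.realize_inf, Formula.realize_relabel,
    Formula.realize_iInf, hψ, Function.comp_apply, Option.elim_some, Option.elim_none,
    Sum.elim_inl, Sum.elim_inr, Sum.elim_comp_inr]
  constructor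
  · rintro ⟨w, hw, h⟩
    rwa [show w = fun i => t i v from funext h] at hw
  · exact fun h => ⟨_, h, fun _ => rfl⟩

/-- Only the finitely many free variables of `φ` matter. The infinite case is needed because
parameters will be indexed by the whole ultrapower. -/
theorem DefRel.realize {ι : Type} (φ : (arithLang X).Formula ι)
    {t : ι → (α → ℕ) → ℕ} (ht : ∀ i, DefFun X (t i)) :
    DefRel X fun v => φ.Realize fun i => t i v := by
  classical
  refine (DefRel.realize_of_finite (φ.restrictFreeVar id : (arithLang X).Formula φ.freeVarFinset)
    fun i => ht i).congr fun v => ?_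
  exact (BoundedFormula.realize_restrictFreeVar (φ := φ) (f := id) (v := fun i => t i v)
    (fun i => t i v) fun _ => rfl).symm

theorem DefRel.realize_bounded {ι : Type} {n : ℕ} (φ : (arithLang X).BoundedFormula ι n)
    {t : ι → (α → ℕ) → ℕ} (ht : ∀ i, DefFun X (t i))
    {s : Fin n → (α → ℕ) → ℕ} (hs : ∀ i, DefFun X (s i)) :
    DefRel X fun v => φ.Realize (fun i => t i v) fun i => s i v := by
  refine (DefRel.realize φ.toFormula (t := Sum.elim t s) ?_).congr fun v => ?_
  · rintro (i | i)
    exacts [ht i, hs i]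
  · rw [BoundedFormula.realize_toFormula]
    exact Iff.rfl

theorem DefRel.eq {t s : (α → ℕ) → ℕ} (ht : DefFun X t) (hs : DefFun X s) :
    DefRel X fun v => t v = s v :=
  DefRel.subst (p := fun v n => n = s v) hs ht

theorem DefRel.lt {t s : (α → ℕ) → ℕ} (ht : DefFun X t) (hs : DefFun X s) :
    DefRel X fun v => t v < s v :=
  DefRel.subst (p := fun v n => n < s v)
    (DefRel.subst (p := fun w n => w none < n) (DefRel.lt_var _ _) hs.weaken) ht

theorem DefRel.mem {A : Set ℕ} (hA : A ∈ X) {t : (α → ℕ) → ℕ} (ht : DefFun X t) :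
    DefRel X fun v => t v ∈ A :=
  DefRel.subst (p := fun _ n => n ∈ A) (DefRel.mem_var hA _) ht

theorem DefFun.term (u : (arithLang X).Term α) : DefFun X fun v => u.realize v :=
  ⟨Term.equal (Term.var none) (u.relabel some), fun v => by
    rw [Formula.realize_equal, Term.realize_relabel]; exact Iff.rfl⟩

/-- Composition of definable functions. -/
theorem DefFun.comp {ι : Type} [Finite ι] {u : (ι → ℕ) → ℕ} (hu : DefFun X u)
    {t : ι → (α → ℕ) → ℕ} (ht : ∀ i, DefFun X (t i)) : DefFun X fun v => u fun i => t i v := by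
  obtain ⟨φ, hφ⟩ := hu
  refine (DefRel.realize_of_finite φ
    (t := fun o w => o.elim (w none) fun i => t i fun a => w (some a)) ?_).congr fun w => ?_
  · rintro (_ | i)
    exacts [DefFun.var _, (ht i).weaken]
  · rw [hφ]
    exact Iff.rfl

theorem DefFun.comp₁ {u : ℕ → ℕ} (hu : DefFun X fun w : Fin 1 → ℕ => u (w 0))
    {t : (α → ℕ) → ℕ} (ht : DefFun X t) : DefFun X fun v => u (t v) :=
  hu.comp (t := fun _ => t) fun _ => ht

theorem DefFun.comp₂ {u : ℕ → ℕ → ℕ} (hu : DefFun X fun w : Fin 2 → ℕ => u (w 0) (w 1))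
    {t s : (α → ℕ) → ℕ} (ht : DefFun X t) (hs : DefFun X s) : DefFun X fun v => u (t v) (s v) :=
  hu.comp (t := ![t, s]) fun i => by fin_cases i; exacts [ht, hs]

/-! ### Arithmetic operations, pairing and Gödel's beta function -/

theorem DefFun.one : DefFun X fun _ : α → ℕ => 1 :=
  DefFun.term (Constants.term (oneSym X))

theorem DefFun.add {t s : (α → ℕ) → ℕ} (ht : DefFun X t) (hs : DefFun X s) :
    DefFun X fun v => t v + s v :=
  DefFun.comp₂ (u := (· + ·)) (DefFun.term ((addSym X).apply₂ (Term.var 0) (Term.var 1))) ht hs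

theorem DefFun.mul {t s : (α → ℕ) → ℕ} (ht : DefFun X t) (hs : DefFun X s) :
    DefFun X fun v => t v * s v :=
  DefFun.comp₂ (u := (· * ·)) (DefFun.term ((mulSym X).apply₂ (Term.var 0) (Term.var 1))) ht hs

theorem DefFun.pair {t s : (α → ℕ) → ℕ} (ht : DefFun X t) (hs : DefFun X s) :
    DefFun X fun v => Nat.pair (t v) (s v) := by
  refine DefFun.comp₂ (u := Nat.pair) ?_ ht hs
  exact ⟨pairFormula X (Term.var none) (Term.var (some 0)) (Term.var (some 1)), fun v =>
    realize_pairFormula X _ _ _ v⟩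

theorem DefFun.unpair_fst {t : (α → ℕ) → ℕ} (ht : DefFun X t) :
    DefFun X fun v => (t v).unpair.1 := by
  refine DefFun.comp₁ (u := fun n => n.unpair.1) ?_ ht
  refine (DefRel.exists (p := fun (w : Option (Fin 1) → ℕ) b => w (some 0) = Nat.pair (w none) b)
    (DefRel.eq (.var _) (.pair (.var _) (.var _)))).congr fun w => ?_
  constructor
  · exact fun h => ⟨(w (some 0)).unpair.2, by rw [h, Nat.pair_unpair]⟩
  · rintro ⟨b, hb⟩
    simp [hb]

theorem DefFun.unpair_snd {t : (α → ℕ) → ℕ} (ht : DefFun X t) :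
    DefFun X fun v => (t v).unpair.2 := by
  refine DefFun.comp₁ (u := fun n => n.unpair.2) ?_ ht
  refine (DefRel.exists (p := fun (w : Option (Fin 1) → ℕ) b => w (some 0) = Nat.pair b (w none))
    (DefRel.eq (.var _) (.pair (.var _) (.var _)))).congr fun w => ?_
  constructor
  · exact fun h => ⟨(w (some 0)).unpair.1, by rw [h, Nat.pair_unpair]⟩
  · rintro ⟨b, hb⟩
    simp [hb]

/-- With a positive modulus the remainder is characterized by division with remainder; the beta
function uses only moduli of this form. -/
theorem DefFun.mod_succ {t s : (α → ℕ) → ℕ} (ht : DefFun X t) (hs : DefFun X s) :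
    DefFun X fun v => t v % (s v + 1) := by
  refine DefFun.comp₂ (u := fun a b => a % (b + 1)) ?_ ht hs
  refine (DefRel.and (DefRel.lt (.var none) (.add (.var (some 1)) .one))
    (DefRel.exists (p := fun (w : Option (Fin 2) → ℕ) q =>
      w (some 0) = w none + (w (some 1) + 1) * q)
    (DefRel.eq (.var _) (.add (.var _) (.mul (.add (.var _) .one) (.var _)))))).congr fun w => ?_
  constructor
  · intro h
    rw [h]
    exact ⟨Nat.mod_lt _ (Nat.succ_pos _), _, (Nat.mod_add_div _ _).symm⟩
  · rintro ⟨h, q, hq⟩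
    simp [hq, Nat.mod_eq_of_lt h]

/-- This makes quantification over finite sequences first-order, and so allows definitions by
course-of-values recursion. -/
theorem DefFun.beta {t s : (α → ℕ) → ℕ} (ht : DefFun X t) (hs : DefFun X s) :
    DefFun X fun v => Nat.beta (t v) (s v) :=
  .mod_succ (.unpair_fst ht) (.mul (.add hs .one) (.unpair_snd ht))

theorem IsCoded.defFun {f : ℕ → ℕ} (hf : IsCoded X f) {t : (α → ℕ) → ℕ} (ht : DefFun X t) :
    DefFun X fun v => f (t v) := by
  refine DefFun.comp₁ (u := f) ?_ ht
  exact ⟨graphFormula X ⟨_, hf⟩ (some 0) none, fun v =>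
    (realize_graphFormula hf _ _ v).trans eq_comm⟩

/-- The bridge from definability to `X`: a set is put into `X` by building its defining condition
from the closure lemmas above. -/
theorem ArithClosed.mem_of_defRel (hX : ArithClosed X) {p : ℕ → Prop}
    (h : DefRel X fun v : Fin 1 → ℕ => p (v 0)) : {n | p n} ∈ X := by
  obtain ⟨φ, hφ⟩ := h
  apply hX
  rw [Set.Definable₁, Set.empty_definable_iff]
  refine ⟨φ, ?_⟩
  ext v
  exact (hφ v).symm

theorem ArithClosed.isCoded_of_defFun (hX : ArithClosed X) {f : ℕ → ℕ}
    (h : DefFun X fun v : Fin 1 → ℕ => f (v 0)) : IsCoded X f :=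
  hX.mem_of_defRel <| DefRel.exists (p := fun (v : Fin 1 → ℕ) n => v 0 = Nat.pair n (f n)) <|
    DefRel.eq (.var _) (.pair (.var _) (DefFun.comp₁ h (.var _)))

end Definability

end Scott

namespace Scott

/-! ### Density of the deciding conditions -/

section Density

variable {X : Set (Set ℕ)}

/-- The leftmost branch through the tree of all finite patterns that the sequence coded by `B`
realizes on an infinite subset of `C`. -/
def leftmostBranch (C B : Set ℕ) (n : ℕ) : Prop :=
  {m | m ∈ C ∧ m ∈ slice B n ∧ ∀ j (_ : j < n), (m ∈ slice B j ↔ leftmostBranch C B j)}.Infinite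
termination_by n

/-- The infinite set of elements following the first `n` choices is split by `B_n`. The branch
enters `B_n` if that half is infinite; otherwise deleting the finite half leaves an infinite set. -/
theorem infinite_leftmostBranch {C : Set ℕ} (hC : C.Infinite) (B : Set ℕ) (n : ℕ) :
    {m | m ∈ C ∧ ∀ j < n, (m ∈ slice B j ↔ leftmostBranch C B j)}.Infinite := by
  induction n with
  | zero => simpa using hC
  | succ n ih =>
    have hn := leftmostBranch.eq_1 C B n
    by_cases h : leftmostBranch C B n
    · refine (hn.mp h).mono ?_
      rintro m ⟨hm, hmn, hj⟩
      refine ⟨hm, fun j hjn => ?_⟩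
      obtain hjn | rfl := Nat.lt_succ_iff_lt_or_eq.1 hjn
      exacts [hj j hjn, iff_of_true hmn h]
    · have hfin := Set.not_infinite.1 (hn.symm ▸ h :)
      refine (ih.sdiff hfin).mono ?_
      rintro m ⟨⟨hm, hj⟩, hmn⟩
      refine ⟨hm, fun j hjn => ?_⟩
      obtain hjn | rfl := Nat.lt_succ_iff_lt_or_eq.1 hjn
      exacts [hj j hjn, iff_of_false (fun h' => hmn ⟨hm, h', hj⟩) h]

/-- The recursion defining `leftmostBranch`, with finite sequences coded by the beta function. -/
theorem leftmostBranch_iff (C B : Set ℕ) (n : ℕ) :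
    leftmostBranch C B n ↔ ∃ s, (∀ i, i < n + 1 → (Nat.beta s i = 1 ↔
      ∀ a, ∃ m, a < m ∧ m ∈ C ∧ Nat.pair i m ∈ B ∧
        ∀ j, j < i → (Nat.pair j m ∈ B ↔ Nat.beta s j = 1))) ∧ Nat.beta s n = 1 := by
  classical
  -- A set of numbers is infinite iff it is unbounded, which makes the recursion clause first-order.
  have hrec : ∀ i, leftmostBranch C B i ↔ ∀ a, ∃ m, a < m ∧ m ∈ C ∧ Nat.pair i m ∈ B ∧
      ∀ j, j < i → (Nat.pair j m ∈ B ↔ leftmostBranch C B j) := by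
    intro i
    rw [leftmostBranch, Set.infinite_iff_exists_gt]
    exact forall_congr' fun a => exists_congr fun m => and_comm
  -- By strong induction the recursion clause has a unique solution up to `n`, so any code `s`
  -- satisfying it agrees with the branch.
  have hagree : ∀ s, (∀ i, i < n + 1 → (Nat.beta s i = 1 ↔
      ∀ a, ∃ m, a < m ∧ m ∈ C ∧ Nat.pair i m ∈ B ∧
        ∀ j, j < i → (Nat.pair j m ∈ B ↔ Nat.beta s j = 1))) →
      ∀ i, i < n + 1 → (Nat.beta s i = 1 ↔ leftmostBranch C B i) := by
    intro s hs i
    induction i using Nat.strong_induction_on with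
    | _ i ih =>
      intro hi
      rw [hs i hi, hrec i]
      refine forall_congr' fun a => exists_congr fun m => and_congr_right fun _ =>
        and_congr_right fun _ => and_congr_right fun _ => forall_congr' fun j =>
        forall_congr' fun hj => ?_
      rw [ih j hj (hj.trans hi)]
  constructor
  · intro h
    -- The witness `s` is the beta code of the truth values of the branch up to and including `n`.
    let l : List ℕ := (List.range (n + 1)).map fun i => if leftmostBranch C B i then 1 else 0
    have hl : ∀ i, i < n + 1 → (Nat.beta (Nat.unbeta l) i = 1 ↔ leftmostBranch C B i) := by
      intro i hi
      have := Nat.beta_unbeta_coe l ⟨i, by simpa [l] using hi⟩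
      simp only [l, Fin.getElem_fin, List.getElem_map, List.getElem_range] at this
      rw [this]
      split_ifs with h' <;> simp [h']
    refine ⟨Nat.unbeta l, fun i hi => ?_, (hl n n.lt_succ_self).2 h⟩
    rw [hl i hi, hrec i]
    refine forall_congr' fun a => exists_congr fun m => and_congr_right fun _ =>
      and_congr_right fun _ => and_congr_right fun _ => forall_congr' fun j =>
      forall_congr' fun hj => ?_
    rw [hl j (hj.trans hi)]
  · rintro ⟨s, hs, hn⟩
    exact (hagree s hs n n.lt_succ_self).1 hn

theorem ArithClosed.leftmostBranch_mem (hX : ArithClosed X) {C B : Set ℕ} (hC : C ∈ X)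
    (hB : B ∈ X) : {n | leftmostBranch C B n} ∈ X := by
  simp only [leftmostBranch_iff]
  apply hX.mem_of_defRel
  refine .exists (.and (.forall (.imp (.lt (.var _) (.add (.var _) .one))
    (.iff (.eq (.beta (.var _) (.var _)) .one) (.forall (.exists (.and (.lt (.var _) (.var _))
    (.and (.mem hC (.var _)) (.and (.mem hB (.pair (.var _) (.var _)))
    (.forall (.imp (.lt (.var _) (.var _)) (.iff (.mem hB (.pair (.var _) (.var _)))
      (.eq (.beta (.var _) (.var _)) .one)))))))))))) (.eq (.beta (.var _) (.var _)) .one))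

/-- Every condition has an extension that is almost contained in `B_n` or almost disjoint from it,
for every `n`, with the choice coded in `X`. -/
theorem ArithClosed.exists_le_forall_finite (hX : ArithClosed X) (C : ModFin X) {B : Set ℕ}
    (hB : B ∈ X) : ∃ E : ModFin X, E ≤ C ∧ ∃ P ∈ X, ∀ n,
      (n ∈ P → (E.carrier \ slice B n).Finite) ∧ (n ∉ P → (E.carrier ∩ slice B n).Finite) := by
  classical
  set P : Set ℕ := {n | leftmostBranch C.carrier B n} with hP
  have hPX : P ∈ X := hX.leftmostBranch_mem C.mem hB
  -- `Q n m`: the element `m` of `C` follows the first `n` choices. The clause `n ≤ m`, written `n <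
  -- m + 1`, forces the witnesses for growing `n` to be unbounded.
  let Q : ℕ → ℕ → Prop := fun n m =>
    n < m + 1 ∧ m ∈ C.carrier ∧ ∀ j, j < n → (Nat.pair j m ∈ B ↔ j ∈ P)
  have hQ : ∀ n, ∃ m, Q n m := by
    intro n
    obtain ⟨m, ⟨hm, hj⟩, hnm⟩ :=
      Set.infinite_iff_exists_gt.1 (infinite_leftmostBranch C.infinite B n) n
    exact ⟨m, by omega, hm, hj⟩
  -- The diagonal set: for each `n`, the least `m` with `Q n m`.
  let E : Set ℕ := {m | ∃ n, Q n m ∧ ∀ k, k < m → ¬ Q n k}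
  have hEX : E ∈ X := by
    apply hX.mem_of_defRel
    have hQd : ∀ {α : Type} {t s : (α → ℕ) → ℕ}, DefFun X t → DefFun X s →
        DefRel X fun v => Q (t v) (s v) := fun ht hs =>
      .and (.lt ht (.add hs .one)) (.and (.mem C.mem hs) (.forall (.imp (.lt (.var _) ht.weaken)
        (.iff (.mem hB (.pair (.var _) hs.weaken)) (.mem hPX (.var _))))))
    exact .exists (.and (hQd (.var _) (.var _))
      (.forall (.imp (.lt (.var _) (.var _)) (.not (hQd (.var _) (.var _))))))
  have hEinf : E.Infinite := by
    rw [Set.infinite_iff_exists_gt]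
    intro a
    have h := Nat.find_spec (hQ (a + 1))
    exact ⟨Nat.find (hQ (a + 1)), ⟨a + 1, h, fun k hk => Nat.find_min _ hk⟩,
      by have := h.1; omega⟩
  have hEC : E ⊆ C.carrier := fun m ⟨n, hn, _⟩ => hn.2.1
  -- An element picked at stage `n` obeys every choice below `n`. Violations of choice `i` therefore
  -- come only from stages `n ≤ i`, each of which contributes one element.
  have hEP : ∀ i, {m ∈ E | ¬ (Nat.pair i m ∈ B ↔ i ∈ P)}.Finite := by
    intro i
    refine ((Set.finite_Iic i).image fun n => Nat.find (hQ n)).subset ?_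
    rintro m ⟨⟨n, hn, hmin⟩, hm⟩
    refine ⟨n, ?_, (Nat.find_eq_iff _).2 ⟨hn, hmin⟩⟩
    by_contra hni
    exact hm (hn.2.2 i (not_le.1 hni))
  refine ⟨⟨E, hEX, hEinf⟩, ?_, P, hPX, fun n => ⟨fun hn => ?_, fun hn => ?_⟩⟩
  · change (E \ C.carrier).Finite
    rw [Set.sdiff_eq_empty.2 hEC]
    exact Set.finite_empty
  · refine (hEP n).subset fun m hm => ⟨hm.1, fun h => hm.2 (h.2 hn)⟩
  · refine (hEP n).subset fun m hm => ⟨hm.1, fun h => hn (h.1 hm.2)⟩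

theorem ArithClosed.singleton_mem (hX : ArithClosed X) (k : ℕ) : {k} ∈ X :=
  hX.mem_of_defRel (.eq (.var _) ((hX.isCoded_const k).defFun (.var 0)))

theorem ArithClosed.compl_mem (hX : ArithClosed X) {A : Set ℕ} (hA : A ∈ X) : Aᶜ ∈ X :=
  hX.mem_of_defRel (.not (.mem hA (.var _)))

theorem ArithClosed.inter_mem (hX : ArithClosed X) {A B : Set ℕ} (hA : A ∈ X) (hB : B ∈ X) :
    A ∩ B ∈ X :=
  hX.mem_of_defRel (.and (.mem hA (.var _)) (.mem hB (.var _)))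

theorem ArithClosed.univ_mem (hX : ArithClosed X) : Set.univ ∈ X := by
  simpa using hX.eq_mem (hX.isCoded_const 0) (hX.isCoded_const 0)

theorem ArithClosed.slice_mem (hX : ArithClosed X) {B : Set ℕ} (hB : B ∈ X) (n : ℕ) :
    slice B n ∈ X :=
  hX.mem_of_defRel (.mem hB (.pair ((hX.isCoded_const n).defFun (.var 0)) (.var _)))

theorem UltrafilterOn.compl_notMem (U : UltrafilterOn X) {A : Set ℕ} (hA : A ∈ U.sets) :
    Aᶜ ∉ U.sets := fun h => U.empty_notMem <| by
  simpa using U.inter_mem _ hA _ h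

/-- An ultrafilter containing no singleton contains all cofinite sets. -/
theorem UltrafilterOn.compl_mem_of_finite (hX : ArithClosed X) (U : UltrafilterOn X)
    (hU : ∀ k, {k} ∉ U.sets) {F : Set ℕ} (hF : F.Finite) : Fᶜ ∈ U.sets := by
  induction F, hF using Set.Finite.induction_on with
  | empty => simpa using U.univ_mem
  | @insert a s _ _ ih =>
    have := U.inter_mem _ ((U.mem_or_compl_mem _ (hX.singleton_mem a)).resolve_left (hU a)) _ ih
    rwa [← Set.compl_union] at this

/-- The conditions deciding the sequence coded by `B` are dense. -/
theorem ArithClosed.isDense_decidingSet (hX : ArithClosed X) {B : Set ℕ} (hB : B ∈ X) :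
    Forcing.IsDense (decidingSet X B) := by
  intro C
  obtain ⟨E, hEC, P, hP, h⟩ := hX.exists_le_forall_finite C hB
  refine ⟨E, fun U hEU => ?_, hEC⟩
  -- Deciding quantifies over all ultrafilters, including those generated by a singleton `{k}`; for
  -- these `B_n ∈ U` just means `k ∈ B_n`.
  by_cases hU : ∃ k, {k} ∈ U.sets
  · obtain ⟨k, hk⟩ := hU
    have hiff : ∀ n, slice B n ∈ U.sets ↔ Nat.pair n k ∈ B := by
      refine fun n => ⟨fun hn => ?_, fun hn => U.mem_of_superset _ hk _ (hX.slice_mem hB n)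
        (Set.singleton_subset_iff.2 hn)⟩
      by_contra hnk
      refine U.empty_notMem ?_
      have hkn : {k} ∩ slice B n = ∅ := Set.singleton_inter_eq_empty.2 hnk
      exact hkn ▸ U.inter_mem _ hk _ hn
    simp only [hiff]
    exact hX.mem_of_defRel (.mem hB (.pair (.var _) ((hX.isCoded_const k).defFun (.var 0))))
  -- Now finite errors are negligible for `U`, so `E ∈ U` gives `B_n ∈ U` exactly when `n ∈ P`.
  · have hcof := fun (F : Set ℕ) (hF : F.Finite) => U.compl_mem_of_finite hX (not_exists.1 hU) hF
    convert hP using 1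
    ext n
    refine ⟨fun hn => ?_, fun hn => ?_⟩
    · by_contra hnP
      exact U.compl_notMem (U.inter_mem _ hEU _ hn) (hcof _ ((h n).2 hnP))
    · refine U.mem_of_superset _ (U.inter_mem _ hEU _ (hcof _ ((h n).1 hn))) _
        (hX.slice_mem hB n) ?_
      rintro m ⟨hm, hm'⟩
      by_contra hmn
      exact hm' ⟨hm, hmn⟩

end Density

end Scott

namespace Scott

/-! ### Łoś's theorem for ultrapowers by coded functions -/

section Los

variable {X : Set (Set ℕ)} (hX : ArithClosed X) (G : UltrafilterOn X) {α : Type}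

theorem Ultrapower.mk_eq_mk {f g : CodedFun X} :
    Ultrapower.mk hX G f = Ultrapower.mk hX G g ↔ {n | f.1 n = g.1 n} ∈ G.sets :=
  Quotient.eq (r := ultraSetoid hX G)

theorem ArithClosed.isCoded_term {X : Set (Set ℕ)} (hX : ArithClosed X)
    (t : (arithLang X).Term α) (f : α → CodedFun X) :
    IsCoded X fun n => t.realize fun i => (f i).1 n := by
  induction t with
  | var i => exact (f i).2
  | func F ts ih => exact hX.isCoded_funMap F _ ih

theorem Ultrapower.realize_term_mk (t : (arithLang X).Term α) (f : α → CodedFun X) :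
    t.realize (fun i => Ultrapower.mk hX G (f i)) =
      Ultrapower.mk hX G ⟨_, hX.isCoded_term t f⟩ := by
  induction t with
  | var i => rfl
  | func F ts ih =>
    simp only [Term.realize_func, ih]
    exact funMap_quotient_mk' (ultraSetoid hX G) F
      fun i => (⟨_, hX.isCoded_term (ts i) f⟩ : CodedFun X)

/-- Induction on `φ`. The truth sets lie in `X` by arithmetic closure, so maximality of `G` handles
implication; the universal quantifier needs a coded function choosing counterexamples. -/
theorem Ultrapower.realize_bounded_mk {n : ℕ} (φ : (arithLang X).BoundedFormula α n)
    (f : α → CodedFun X) (g : Fin n → CodedFun X) :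
    φ.Realize (fun i => Ultrapower.mk hX G (f i)) (fun i => Ultrapower.mk hX G (g i)) ↔
      {k | φ.Realize (fun i => (f i).1 k) fun i => (g i).1 k} ∈ G.sets := by
  have helim : ∀ {n : ℕ} (g : Fin n → CodedFun X),
      Sum.elim (fun i => Ultrapower.mk hX G (f i)) (fun i => Ultrapower.mk hX G (g i)) =
        fun i => Ultrapower.mk hX G (Sum.elim f g i) := fun g => by
    ext (i | i) <;> rfl
  have helim' : ∀ {n : ℕ} (g : Fin n → CodedFun X) (k : ℕ),
      Sum.elim (fun i => (f i).1 k) (fun i => (g i).1 k) =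
        fun i => (Sum.elim f g i).1 k := fun g k => by
    ext (i | i) <;> rfl
  have hmem : ∀ {n : ℕ} (φ : (arithLang X).BoundedFormula α n) (g : Fin n → CodedFun X),
      {k | φ.Realize (fun i => (f i).1 k) fun i => (g i).1 k} ∈ X := fun φ g =>
    hX.mem_of_defRel (.realize_bounded φ (fun i => (f i).2.defFun (.var 0))
      fun i => (g i).2.defFun (.var 0))
  induction φ with
  | falsum => simpa [BoundedFormula.Realize] using G.empty_notMem
  | equal t₁ t₂ =>
    simp only [BoundedFormula.Realize, helim, helim', Ultrapower.realize_term_mk]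
    exact Ultrapower.mk_eq_mk hX G
  | rel r ts =>
    simp only [BoundedFormula.Realize, helim, helim', Ultrapower.realize_term_mk]
    exact relMap_quotient_mk' (ultraSetoid hX G) r
      fun i => (⟨_, hX.isCoded_term (ts i) (Sum.elim f g)⟩ : CodedFun X)
  | imp φ ψ ihφ ihψ =>
    simp only [BoundedFormula.realize_imp, ihφ, ihψ]
    refine ⟨fun h => ?_, fun h hφ => ?_⟩
    · by_cases hφ : {k | φ.Realize (fun i => (f i).1 k) fun i => (g i).1 k} ∈ G.sets
      · exact G.mem_of_superset _ (h hφ) _ (hmem (φ.imp ψ) g) fun k hk _ => hk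
      · exact G.mem_of_superset _ ((G.mem_or_compl_mem _ (hmem φ g)).resolve_left hφ) _
          (hmem (φ.imp ψ) g) fun k hk hk' => absurd hk' hk
    · exact G.mem_of_superset _ (G.inter_mem _ h _ hφ) _ (hmem ψ g) fun k hk => hk.1 hk.2
  | @all n ψ ih =>
    have hsnoc : ∀ c : CodedFun X,
        (Fin.snoc (fun i => Ultrapower.mk hX G (g i)) (Ultrapower.mk hX G c) : Fin (n + 1) → _) =
          fun i => Ultrapower.mk hX G ((Fin.snoc g c : Fin (n + 1) → CodedFun X) i) := fun c => by
      ext i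
      refine Fin.lastCases ?_ (fun i => ?_) i <;> simp
    have hsnoc' : ∀ (c : CodedFun X) (k : ℕ),
        (fun i => ((Fin.snoc g c : Fin (n + 1) → CodedFun X) i).1 k) =
          (Fin.snoc (fun i => (g i).1 k) (c.1 k) : Fin (n + 1) → ℕ) := fun c k => by
      ext i
      refine Fin.lastCases ?_ (fun i => ?_) i <;> simp
    have key : ∀ c : CodedFun X, ψ.Realize (fun i => Ultrapower.mk hX G (f i))
        (Fin.snoc (fun i => Ultrapower.mk hX G (g i)) (Ultrapower.mk hX G c)) ↔
        {k | ψ.Realize (fun i => (f i).1 k)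
          (Fin.snoc (fun i => (g i).1 k) (c.1 k))} ∈ G.sets := fun c => by
      simp only [hsnoc, ih, hsnoc']
    have hmem' : ∀ c : CodedFun X, {k | ψ.Realize (fun i => (f i).1 k)
          (Fin.snoc (fun i => (g i).1 k) (c.1 k))} ∈ X := fun c => by
      simpa only [hsnoc'] using hmem ψ (Fin.snoc g c)
    simp only [BoundedFormula.realize_all]
    refine ⟨fun h => ?_, fun h x => ?_⟩
    -- Apply the hypothesis to the class of a function `c` choosing counterexamples: wherever `ψ`
    -- holds at `c k`, no counterexample exists, so the universal statement holds at `k`.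
    · classical
      let R : ℕ → ℕ → Prop := fun k a =>
        ψ.Realize (fun i => (f i).1 k) (Fin.snoc (fun i => (g i).1 k) a)
      -- the least counterexample, where there is one
      let c : ℕ → ℕ := fun k => if hk : ∃ a, ¬ R k a then Nat.find hk else 0
      have hR : ∀ {β : Type} {t s : (β → ℕ) → ℕ}, DefFun X t → DefFun X s →
          DefRel X fun v => R (t v) (s v) := fun {β t s} ht hs => by
        refine (DefRel.realize_bounded ψ (t := fun i v => (f i).1 (t v))
          (s := (Fin.snoc (fun i v => (g i).1 (t v)) s : Fin (n + 1) → (β → ℕ) → ℕ))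
          (fun i => (f i).2.defFun ht) ?_).congr fun v => ?_
        · intro i
          refine Fin.lastCases ?_ (fun i => ?_) i
          · simpa using hs
          · simpa using (g i).2.defFun ht
        · refine iff_of_eq (congrArg (ψ.Realize fun i => (f i).1 (t v)) ?_)
          ext i
          refine Fin.lastCases ?_ (fun i => ?_) i <;> simp
      have hc : IsCoded X c := by
        apply hX.isCoded_of_defFun
        -- The graph of `c`: either the value is the least counterexample, or there is none and the
        -- value is the default `0`.
        refine (DefRel.or (DefRel.and (.not (hR (.var (some 0)) (.var none)))
          (DefRel.forall (p := fun (w : Option (Fin 1) → ℕ) b => b < w none → R (w (some 0)) b)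
            (.imp (.lt (.var _) (.var _)) (hR (.var _) (.var _)))))
          (DefRel.and
            (DefRel.forall (p := fun (w : Option (Fin 1) → ℕ) b => R (w (some 0)) b)
              (hR (.var _) (.var _)))
            (.eq (.var none) ((hX.isCoded_const 0).defFun (.var none))))).congr fun w => ?_
        by_cases hk : ∃ a, ¬ R (w (some 0)) a
        · have hk' := not_forall.2 hk
          simp only [c, dif_pos hk, hk', false_and, or_false]
          rw [eq_comm, Nat.find_eq_iff]
          simp only [not_not]
        · have hk' := not_exists_not.1 hk
          simp [c, hk']
      have hcG := (key ⟨c, hc⟩).1 (h _)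
      refine G.mem_of_superset _ hcG _ (hmem ψ.all g) fun k hk => ?_
      by_contra hk'
      have hex : ∃ a, ¬ R k a := not_forall.1 hk'
      refine Nat.find_spec hex ?_
      have hck : c k = Nat.find hex := dif_pos hex
      rw [← hck]
      exact hk
    · induction x using Quotient.inductionOn with
      | _ c => exact (key c).2 (G.mem_of_superset _ h _ (hmem' c) fun k hk => hk _)

theorem Ultrapower.realize_mk (φ : (arithLang X).Formula α) (f : α → CodedFun X) :
    φ.Realize (fun i => Ultrapower.mk hX G (f i)) ↔
      {k | φ.Realize fun i => (f i).1 k} ∈ G.sets := by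
  have := Ultrapower.realize_bounded_mk hX G φ f finZeroElim
  simpa only [Formula.Realize, Unique.eq_default] using this

/-- The canonical elementary embedding `n ↦ [c_n]_G`. -/
def Ultrapower.constEmbedding : ℕ ↪ₑ[arithLang X] Ultrapower hX G where
  toFun n := Ultrapower.mk hX G ⟨fun _ => n, hX.isCoded_const n⟩
  map_formula' n φ x := by
    refine (Ultrapower.realize_mk hX G φ
      fun i => ⟨fun _ => x i, hX.isCoded_const (x i)⟩).trans ?_
    by_cases h : φ.Realize x
    · simpa [h] using G.univ_mem
    · simpa [h] using G.empty_notMem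

/-- The identity function agrees with a constant function at only one number, and `G` has no finite
members. -/
theorem Ultrapower.not_surjective_constEmbedding (hG : G.Nonprincipal) :
    ¬ Function.Surjective (Ultrapower.constEmbedding hX G) := by
  intro h
  obtain ⟨n, hn⟩ := h (Ultrapower.mk hX G ⟨fun k => k, hX.isCoded_of_defFun (.var 0)⟩)
  refine hG _ ((Ultrapower.mk_eq_mk hX G).1 hn) ((Set.finite_singleton n).subset ?_)
  exact fun k hk => Eq.symm hk

/-- If `G` is nonprincipal and computes every coded sequence, then the ultrapower is a
conservative extension. -/
theorem Ultrapower.isConservative_constEmbedding (hG : G.Nonprincipal)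
    (h : ∀ B ∈ X, {n | slice B n ∈ G.sets} ∈ X) :
    IsConservative (Ultrapower.constEmbedding hX G) := by
  refine ⟨Ultrapower.not_surjective_constEmbedding hX G hG, fun D hD => ?_⟩
  rw [Set.Definable₁, Set.definable_iff_exists_formula_sum] at hD
  obtain ⟨φ, hφ⟩ := hD
  have hrep : ∀ a : (Set.univ : Set (Ultrapower hX G)), ∃ f, Ultrapower.mk hX G f = a.1 :=
    fun a => Quotient.exists_rep a.1
  choose f hf using hrep
  -- In a pair `⟨n, k⟩`, the first entry is the number tested for membership in `D` and the second
  -- the index at which the parameters' representatives are evaluated. Thus the slice at `n` is the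
  -- Łoś set of `φ` at `[c_n]`.
  let B : Set ℕ := {k | φ.Realize (Sum.elim (fun a => (f a).1 k.unpair.2) fun _ => k.unpair.1)}
  have hB : B ∈ X := by
    apply hX.mem_of_defRel
    refine (DefRel.realize φ (t := Sum.elim (fun a v => (f a).1 (v 0).unpair.2)
      fun _ v => (v 0).unpair.1) ?_).congr fun v => ?_
    · rintro (a | _)
      exacts [(f a).2.defFun (.unpair_snd (.var 0)), .unpair_fst (.var 0)]
    · refine iff_of_eq (congrArg _ ?_)
      ext (a | _) <;> rfl
  have hpre : Ultrapower.constEmbedding hX G ⁻¹' D = {n | slice B n ∈ G.sets} := by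
    ext n
    have hn : Ultrapower.constEmbedding hX G n ∈ D ↔
        φ.Realize (Sum.elim (fun a => a.1) fun _ => Ultrapower.constEmbedding hX G n) :=
      (Set.ext_iff.1 hφ) fun _ => Ultrapower.constEmbedding hX G n
    rw [Set.mem_preimage, hn]
    let e : (Set.univ : Set (Ultrapower hX G)) ⊕ Fin 1 → CodedFun X :=
      Sum.elim f fun _ => ⟨fun _ => n, hX.isCoded_const n⟩
    have hlos := Ultrapower.realize_mk hX G φ e
    have he : (fun i => Ultrapower.mk hX G (e i)) =
        (Sum.elim (fun a => a.1) fun _ => Ultrapower.constEmbedding hX G n) := by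
      ext (a | _)
      exacts [hf a, rfl]
    rw [he] at hlos
    rw [hlos, Set.mem_ofPred_eq]
    refine iff_of_eq (congrArg (· ∈ G.sets) ?_)
    ext k
    simp only [slice, B, Set.mem_ofPred_eq, Nat.unpair_pair]
    refine iff_of_eq (congrArg _ ?_)
    ext (a | _) <;> rfl
  rw [hpre]
  -- The trace of `D` is itself a member of `X`, so its own predicate symbol defines it without
  -- parameters.
  refine Set.Definable.mono (A := ∅) ?_ (Set.empty_subset _)
  rw [Set.empty_definable_iff]
  obtain ⟨ψ, hψ⟩ := DefRel.mem_var (h B hB) (0 : Fin 1)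
  exact ⟨ψ, Set.ext fun v => (hψ v).symm⟩

end Los

/-! ### The generic ultrafilter -/

section Generic

variable {X : Set (Set ℕ)}

/-- The conditions that decide whether `A` belongs to the generic filter. -/
def splittingSet (X : Set (Set ℕ)) (A : Set ℕ) : Set (ModFin X) :=
  {C | (C.carrier \ A).Finite ∨ (C.carrier \ Aᶜ).Finite}

/-- If `C ∩ A` is infinite, it is an extension inside `A`; otherwise `C` itself is almost contained
in the complement. -/
theorem ArithClosed.isDense_splittingSet (hX : ArithClosed X) {A : Set ℕ} (hA : A ∈ X) :
    Forcing.IsDense (splittingSet X A) := by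
  intro C
  by_cases h : (C.carrier ∩ A).Infinite
  · refine ⟨⟨_, hX.inter_mem C.mem hA, h⟩, Or.inl ?_, ?_⟩
    · exact Set.finite_empty.subset fun n hn => hn.2 hn.1.2
    · exact Set.finite_empty.subset fun n hn => hn.2 hn.1.1
  · refine ⟨C, Or.inr ?_, le_rfl⟩
    rw [Set.sdiff_compl]
    exact Set.not_infinite.1 h

/-- A filter on `X/Fin` that meets all the sets `splittingSet X A` is an ultrafilter on `X`. -/
def genericUltrafilter (hX : ArithClosed X) (F : Order.PFilter (ModFin X))
    (hF : ∀ A ∈ X, ∃ C ∈ F, C ∈ splittingSet X A) : UltrafilterOn X where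
  sets := {A | A ∈ X ∧ ∃ C ∈ F, (C.carrier \ A).Finite}
  sub := fun A hA => hA.1
  univ_mem := by
    obtain ⟨C, hC⟩ := F.nonempty
    exact ⟨hX.univ_mem, C, hC, by simp⟩
  empty_notMem := by
    rintro ⟨-, C, -, hC⟩
    exact C.infinite (by simpa using hC)
  inter_mem := by
    rintro A ⟨hA, C, hC, hCA⟩ B ⟨hB, D, hD, hDB⟩
    obtain ⟨E, hE, hEC, hED⟩ := F.directed C hC D hD
    refine ⟨hX.inter_mem hA hB, E, hE, ?_⟩
    have hEC' : (E.carrier \ C.carrier).Finite := hEC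
    have hED' : (E.carrier \ D.carrier).Finite := hED
    refine ((hEC'.union hCA).union (hED'.union hDB)).subset fun n hn => ?_
    simp only [Set.mem_sdiff, Set.mem_union, Set.mem_inter_iff] at hn ⊢
    tauto
  mem_of_superset := by
    rintro A ⟨hA, C, hC, hCA⟩ B hB hAB
    exact ⟨hB, C, hC, hCA.subset (Set.sdiff_subset_sdiff_right hAB)⟩
  mem_or_compl_mem := by
    intro A hA
    obtain ⟨C, hC, h | h⟩ := hF A hA
    exacts [Or.inl ⟨hA, C, hC, h⟩, Or.inr ⟨hX.compl_mem hA, C, hC, h⟩]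

theorem genericUltrafilter_nonprincipal (hX : ArithClosed X) (F : Order.PFilter (ModFin X))
    (hF : ∀ A ∈ X, ∃ C ∈ F, C ∈ splittingSet X A) :
    (genericUltrafilter hX F hF).Nonprincipal := by
  rintro A ⟨-, C, -, hC⟩ hA
  refine C.infinite ((hC.union hA).subset fun n hn => ?_)
  by_cases h : n ∈ A
  exacts [Or.inr h, Or.inl ⟨hn, h⟩]

theorem mem_genericUltrafilter (hX : ArithClosed X) {F : Order.PFilter (ModFin X)}
    (hF : ∀ A ∈ X, ∃ C ∈ F, C ∈ splittingSet X A) {C : ModFin X} (hC : C ∈ F) :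
    C.carrier ∈ (genericUltrafilter hX F hF).sets :=
  ⟨C.mem, C, hC, by simp⟩

end Generic

end Scott

/-! ### The Proper Forcing Axiom applied to `X/Fin` -/

theorem theoremf (pfa : Forcing.ProperForcingAxiom.{0}) (X : Set (Set ℕ))
    (hX : Scott.IsProperScottSet X) (hcard : #X = ℵ₁) :
    ∃ G : Scott.UltrafilterOn X, G.Nonprincipal ∧
      (∀ B ∈ X, Forcing.IsDense (Scott.decidingSet X B) ∧
        ∃ C ∈ Scott.decidingSet X B, C.carrier ∈ G.sets) ∧
      ∃ j : ℕ ↪ₑ[Scott.arithLang X] Scott.Ultrapower hX.arithClosed G,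
        (∀ n : ℕ, j n = Scott.Ultrapower.mk hX.arithClosed G
          ⟨fun _ => n, hX.arithClosed.isCoded_const n⟩) ∧
        Scott.IsConservative j := by
  have hA := hX.arithClosed
  have : Nonempty (Scott.ModFin X) := ⟨⟨Set.univ, hA.univ_mem, Set.infinite_univ⟩⟩
  obtain ⟨F, hF⟩ := pfa (Scott.ModFin X) hX.isProper
    (Scott.splittingSet X '' X ∪ Scott.decidingSet X '' X)
    (by
      refine (mk_union_le _ _).trans ?_
      -- Both families are indexed by `X`, and ℵ₁ + ℵ₁ = ℵ₁.
      rw [← add_eq_self (aleph0_le_aleph 1), ← hcard]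
      exact add_le_add mk_image_le mk_image_le)
    (by
      rintro _ (⟨A, h, rfl⟩ | ⟨B, h, rfl⟩)
      exacts [hA.isDense_splittingSet h, hA.isDense_decidingSet h])
  have hsplit : ∀ A ∈ X, ∃ C ∈ F, C ∈ Scott.splittingSet X A :=
    fun A h => hF _ (Or.inl ⟨A, h, rfl⟩)
  have hdec : ∀ B ∈ X, ∃ C ∈ Scott.decidingSet X B,
      C.carrier ∈ (Scott.genericUltrafilter hA F hsplit).sets := fun B h => by
    obtain ⟨C, hC, hCB⟩ := hF _ (Or.inr ⟨B, h, rfl⟩)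
    exact ⟨C, hCB, Scott.mem_genericUltrafilter hA hsplit hC⟩
  have hnp := Scott.genericUltrafilter_nonprincipal hA F hsplit
  refine ⟨Scott.genericUltrafilter hA F hsplit, hnp,
    fun B h => ⟨hA.isDense_decidingSet h, hdec B h⟩,
    Scott.Ultrapower.constEmbedding hA _, fun n => rfl,
    Scott.Ultrapower.isConservative_constEmbedding hA _ hnp fun B h => ?_⟩
  -- `G` contains a condition deciding `B`, and `G` is one of the ultrafilters over which deciding
  -- quantifies.
  obtain ⟨C, hC, hCG⟩ := hdec B h
  exact hC _ hCG
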